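/- Let $P(\mathbb{R})$ be the set of $f\in L^1(\mathbb{R})$ with $f\ge 0$ and $\int_{\mathbb{R}} f(t)\,dt=1$ (as usual, relations between elements of $L^1(\mathbb{R})$, including evenness $f(-t)=f(t)$, hold almost everywhere). For $f\in P(\mathbb{R})$ and $r>0$ put $f_r(t)=r^{-1}f(t/r)$, and for a complex-valued $\phi\in L^\infty(\mathbb{R})$ put $$(f*\phi)(x)=\int_{\mathbb{R}}\phi(x-t)f(t)\,dt\qquad(x\in\mathbb{R}).$$ Theorem 4.5. Let $\phi\in L^\infty(\mathbb{R})$, and let $f\in P(\mathbb{R})$ be even with $$\int_0^\infty f(t)\,t^{i\xi}\,dt\neq 0\qquad\text{for every }\xi\in\mathbb{R}.$$ Let $\gamma=0^+$ or $\gamma=\infty$, let $x\in\mathbb{R}$ and $\alpha\in\mathbb{C}$. If $$\lim_{r\to\gamma}(f_r*\phi)(x)=\alpha,$$ then for every even $g\in P(\mathbb{R})$, $$\lim_{r\to\gamma}(g_r*\phi)(x)=\alpha.$$ -/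

import Mathlib

open MeasureTheory Filter Topology
open scoped Convolution ENNReal

/-- `f ∈ P(ℝ)`: `f` is (a representative of) an element of `L¹(ℝ)` with `f ≥ 0` almost everywhere
and `∫ f = 1`. -/
structure MemP (f : ℝ → ℝ) : Prop where
  integrable : Integrable f volume
  nonneg : ∀ᵐ x : ℝ, 0 ≤ f x
  integral_eq_one : ∫ x : ℝ, f x = 1

/-- Evenness of (the class of) a function on the line: `f (-x) = f x` for almost every `x`. -/
def IsEvenAE (f : ℝ → ℝ) : Prop :=
  ∀ᵐ x : ℝ, f (-x) = f x

/-- The dilation `f_r(x) = r⁻¹ f(x / r)`; it is used for `r > 0` only. -/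
noncomputable def dilate (f : ℝ → ℝ) (r : ℝ) : ℝ → ℝ :=
  fun x => r⁻¹ * f (x / r)

/-! Evenness folds the integral onto (0, ∞), and r = e^{-ρ}, t = e^{-u} turn dilation into
translation: `(f_r * φ)(x)` becomes the correlation of the bounded function φ(x - e^{-u}) + φ(x +
e^{-u}) with the integrable kernel `logKernel f`, whose Fourier transform is the given nonvanishing
integral. The claim is then Wiener's Tauberian theorem at ±∞ (`wiener_tauberian`).

Wiener's theorem is proved by a local contraction. Suppose c = ∫ F ≠ 0, and let k be a wide kernel
with Fourier transform 1 near 0. Then F * k is L¹-close to c k, since k hardly changes at the scale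
of F. If θ is the correlation of ψ with a kernel of narrow spectrum, then k reproduces θ, so `corr θ
F` = cθ + `corr θ D` with ‖D‖₁ < |c|. The left side tends to 0, which forces θ → 0
(`tendsto_zero_of_eq_add_corr`). Modulation carries this to every frequency, smooth splitting over a
compact spectrum glues the pieces (`tendsto_corr_fourierInv`), and band-limited approximate
identities reach every integrable G. -/

/-- The correlation `ρ ↦ ∫ G(y) ψ(ρ + y) dy` of a kernel `G` with a bounded function `ψ`. -/
noncomputable def corr (ψ G : ℝ → ℂ) (ρ : ℝ) : ℂ := ∫ y, G y * ψ (ρ + y)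

/-- The `L¹` modulus of continuity `y ↦ ‖G(· - y) - G‖₁`. -/
noncomputable def translationModulus (G : ℝ → ℂ) (y : ℝ) : ℝ := ∫ z, ‖G (z - y) - G z‖

/-! ### Correlations of bounded functions with integrable kernels -/

section Correlation

variable {ψ F G : ℝ → ℂ} {C : ℝ} {l : Filter ℝ}

lemma integrable_mul_shift (hψ : StronglyMeasurable ψ) (hC : ∀ t, ‖ψ t‖ ≤ C)
    (hG : Integrable G) (ρ : ℝ) : Integrable fun y => G y * ψ (ρ + y) := by
  refine hG.mul_bdd (c := C) ?_ (.of_forall fun y => hC _)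
  exact (hψ.comp_measurable (by fun_prop)).aestronglyMeasurable

lemma norm_corr_le (hC : ∀ t, ‖ψ t‖ ≤ C) (hG : Integrable G) (ρ : ℝ) :
    ‖corr ψ G ρ‖ ≤ C * ∫ y, ‖G y‖ := by
  rw [corr, ← integral_const_mul]
  refine norm_integral_le_of_norm_le (hG.norm.const_mul C) (.of_forall fun y => ?_)
  rw [norm_mul, mul_comm]
  exact mul_le_mul_of_nonneg_right (hC _) (norm_nonneg _)

lemma corr_sub (hψ : StronglyMeasurable ψ) (hC : ∀ t, ‖ψ t‖ ≤ C) (hF : Integrable F)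
    (hG : Integrable G) (ρ : ℝ) : corr ψ (F - G) ρ = corr ψ F ρ - corr ψ G ρ := by
  rw [corr, corr, corr, ← integral_sub (integrable_mul_shift hψ hC hF ρ)
    (integrable_mul_shift hψ hC hG ρ)]
  simp [sub_mul]

lemma corr_add (hψ : StronglyMeasurable ψ) (hC : ∀ t, ‖ψ t‖ ≤ C) (hF : Integrable F)
    (hG : Integrable G) (ρ : ℝ) : corr ψ (F + G) ρ = corr ψ F ρ + corr ψ G ρ := by
  rw [corr, corr, corr, ← integral_add (integrable_mul_shift hψ hC hF ρ)
    (integrable_mul_shift hψ hC hG ρ)]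
  simp [add_mul]

lemma corr_const_mul (c : ℂ) (ρ : ℝ) : corr ψ (fun y => c * G y) ρ = c * corr ψ G ρ := by
  rw [corr, corr, ← integral_const_mul]
  simp [mul_assoc]

lemma corr_congr_ae (h : F =ᵐ[volume] G) : corr ψ F = corr ψ G := by
  ext ρ
  exact integral_congr_ae (h.mono fun y hy => by simp [hy])

lemma stronglyMeasurable_corr (hψ : StronglyMeasurable ψ) (hG : Integrable G) :
    StronglyMeasurable (corr ψ G) := by
  rw [corr_congr_ae hG.1.ae_eq_mk]
  refine StronglyMeasurable.integral_prod_right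
    (f := fun ρ y => hG.1.mk G y * ψ (ρ + y)) ?_
  exact (hG.1.stronglyMeasurable_mk.comp_measurable measurable_snd).mul
    (hψ.comp_measurable (by fun_prop))

lemma corr_corr_comm (hψ : StronglyMeasurable ψ) (hC : ∀ t, ‖ψ t‖ ≤ C) (hF : Integrable F)
    (hG : Integrable G) : corr (corr ψ G) F = corr (corr ψ F) G := by
  ext ρ
  simp only [corr, ← integral_const_mul]
  rw [integral_integral_swap]
  · refine integral_congr_ae (.of_forall fun y => integral_congr_ae (.of_forall fun z => ?_))
    simp only [add_right_comm ρ y z]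
    ring
  · have : Integrable (fun p : ℝ × ℝ => (F p.1 * G p.2) * ψ (ρ + p.1 + p.2))
        (volume.prod volume) := by
      refine (hF.mul_prod hG).mul_bdd (c := C) ?_ (.of_forall fun y => hC _)
      exact (hψ.comp_measurable (by fun_prop)).aestronglyMeasurable
    refine this.congr (.of_forall fun p => ?_)
    simp [Function.uncurry, mul_assoc]

/-- Fubini and translation invariance. Convolution identities between kernels thus become identities
between iterated correlations. -/
lemma corr_convolution (hψ : StronglyMeasurable ψ) (hC : ∀ t, ‖ψ t‖ ≤ C) (hF : Integrable F)
    (hG : Integrable G) :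
    corr ψ (F ⋆[ContinuousLinearMap.mul ℂ ℂ] G) = corr (corr ψ G) F := by
  ext ρ
  have hint := hF.convolution_integrand (ContinuousLinearMap.mul ℂ ℂ) hG
  simp only [ContinuousLinearMap.mul_apply'] at hint
  have h2 : Integrable (fun p : ℝ × ℝ => (F p.2 * G (p.1 - p.2)) * ψ (ρ + p.1))
        (volume.prod volume) := by
      refine hint.mul_bdd (c := C) ?_ (.of_forall fun y => hC _)
      exact (hψ.comp_measurable (by fun_prop)).aestronglyMeasurable
  calc corr ψ (F ⋆[ContinuousLinearMap.mul ℂ ℂ] G) ρ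
      = ∫ z, ∫ y, F y * G (z - y) * ψ (ρ + z) := by
        simp only [corr, convolution, ContinuousLinearMap.mul_apply', integral_mul_const]
    _ = ∫ y, ∫ z, F y * G (z - y) * ψ (ρ + z) := integral_integral_swap h2
    _ = corr (corr ψ G) F ρ := by
        simp only [corr]
        refine integral_congr_ae (.of_forall fun y => ?_)
        simp only [mul_assoc, integral_const_mul]
        rw [← integral_sub_right_eq_self (fun z => G z * ψ (ρ + y + z)) y]
        simp [add_assoc]

/-- Dominated convergence with majorant C‖G‖; invariance of `l` under translations gives the
pointwise limit. -/
lemma tendsto_corr [l.IsCountablyGenerated] (hl : ∀ y : ℝ, Tendsto (fun ρ => ρ + y) l l)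
    (hψ : StronglyMeasurable ψ) (hC : ∀ t, ‖ψ t‖ ≤ C) (hG : Integrable G)
    (h : Tendsto ψ l (𝓝 0)) : Tendsto (corr ψ G) l (𝓝 0) := by
  have := tendsto_integral_filter_of_dominated_convergence (μ := volume) (l := l)
    (F := fun ρ y => G y * ψ (ρ + y)) (f := fun y => 0) (fun y => C * ‖G y‖)
    (.of_forall fun ρ => (integrable_mul_shift hψ hC hG ρ).1)
    (.of_forall fun ρ => .of_forall fun y => by
      rw [norm_mul, mul_comm]
      exact mul_le_mul_of_nonneg_right (hC _) (norm_nonneg _))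
    (hG.norm.const_mul C)
    (.of_forall fun y => by simpa using (h.comp (hl y)).const_mul (G y))
  rw [integral_zero] at this
  exact this

/-- A bounded function that is, up to a null function, its own correlation with a kernel of norm
less than one, is itself null. -/
lemma tendsto_zero_of_eq_add_corr [l.IsCountablyGenerated]
    (hl : ∀ y : ℝ, Tendsto (fun ρ => ρ + y) l l) {θ e W : ℝ → ℂ} (hθ : StronglyMeasurable θ)
    (hC : ∀ t, ‖θ t‖ ≤ C) (hW : Integrable W) (hW1 : ∫ y, ‖W y‖ < 1)
    (he : Tendsto e l (𝓝 0)) (h : ∀ ρ, θ ρ = e ρ + corr θ W ρ) : Tendsto θ l (𝓝 0) := by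
  set w := ∫ y, ‖W y‖ with hw
  have hw0 : 0 ≤ w := integral_nonneg fun _ => norm_nonneg _
  have hC0 : 0 ≤ C := (norm_nonneg _).trans (hC 0)
  -- An asymptotic bound B improves to w * B: the excess of ‖θ‖ over B tends to 0, hence so does its
  -- correlation with ‖W‖, and only the part bounded by B contributes.
  have step (B : ℝ) (hB0 : 0 ≤ B) (hB : ∀ ε > 0, ∀ᶠ ρ in l, ‖θ ρ‖ ≤ B + ε) :
      ∀ ε > 0, ∀ᶠ ρ in l, ‖θ ρ‖ ≤ w * B + ε := by
    intro ε hε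
    set exc : ℝ → ℝ := fun t => max (‖θ t‖ - B) 0 with hexc
    have hexc_lim : Tendsto exc l (𝓝 0) := by
      rw [Metric.tendsto_nhds]
      intro δ hδ
      filter_upwards [hB (δ / 2) (by positivity)] with ρ hρ
      have : exc ρ < δ := max_lt (by linarith) hδ
      rw [Real.dist_eq, sub_zero, abs_of_nonneg (le_max_right _ _)]
      exact this
    have hexc_m : StronglyMeasurable exc :=
      ((hθ.norm.sub stronglyMeasurable_const).sup stronglyMeasurable_const)
    have hexc_le (t) : ‖(exc t : ℂ)‖ ≤ C := by
      rw [Complex.norm_real, Real.norm_of_nonneg (le_max_right _ _)]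
      exact max_le (by linarith [hC t]) hC0
    have hlim := tendsto_corr (ψ := fun t => (exc t : ℂ)) hl
      (Complex.continuous_ofReal.comp_stronglyMeasurable hexc_m) hexc_le
      hW.norm.ofReal (by simpa [Function.comp_def] using (Complex.continuous_ofReal.tendsto 0).comp hexc_lim)
    have h1 := (Metric.tendsto_nhds.1 hlim) (ε / 2) (by positivity)
    have h2 := (Metric.tendsto_nhds.1 he) (ε / 2) (by positivity)
    filter_upwards [h1, h2] with ρ h1 h2
    rw [dist_zero_right] at h1 h2
    have hreal : corr (fun t => (exc t : ℂ)) (fun y => (‖W y‖ : ℂ)) ρ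
        = ((∫ y, ‖W y‖ * exc (ρ + y) : ℝ) : ℂ) := by
      rw [corr, ← integral_complex_ofReal]
      simp
    have hexcI : Integrable fun y => ‖W y‖ * exc (ρ + y) := by
      refine hW.norm.mul_bdd (c := C) ?_ (.of_forall fun y => ?_)
      · exact (hexc_m.comp_measurable (by fun_prop)).aestronglyMeasurable
      · simpa using hexc_le (ρ + y)
    have h3 : ‖corr θ W ρ‖ ≤ w * B + ∫ y, ‖W y‖ * exc (ρ + y) := by
      rw [hw, ← integral_mul_const, ← integral_add (hW.norm.mul_const B) hexcI]
      refine norm_integral_le_of_norm_le ((hW.norm.mul_const B).add hexcI)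
        (.of_forall fun y => ?_)
      rw [norm_mul, ← mul_add]
      refine mul_le_mul_of_nonneg_left ?_ (norm_nonneg _)
      linarith [le_max_left (‖θ (ρ + y)‖ - B) 0]
    replace h1 := hreal ▸ h1
    rw [Complex.norm_real] at h1
    have h4 := (le_abs_self _).trans_lt h1
    calc ‖θ ρ‖ ≤ ‖e ρ‖ + ‖corr θ W ρ‖ := by rw [h ρ]; exact norm_add_le _ _
      _ ≤ w * B + ε := by linarith
  have iter (n : ℕ) : ∀ ε > 0, ∀ᶠ ρ in l, ‖θ ρ‖ ≤ w ^ n * C + ε := by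
    induction n with
    | zero => exact fun ε hε => .of_forall fun ρ => by linarith [hC ρ, pow_zero w]
    | succ n ih =>
      have := step (w ^ n * C) (by positivity) ih
      simpa [pow_succ', mul_assoc] using this
  rw [Metric.tendsto_nhds]
  intro ε hε
  have hlim : Tendsto (fun n : ℕ => w ^ n * C) atTop (𝓝 0) := by
    simpa using (tendsto_pow_atTop_nhds_zero_of_lt_one hw0 hW1).mul_const C
  obtain ⟨n, hn⟩ := (hlim.eventually (gt_mem_nhds (half_pos hε))).exists
  filter_upwards [iter n (ε / 3) (by positivity)] with ρ hρ
  rw [dist_zero_right]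
  linarith

end Correlation

/-! ### The L¹ modulus of continuity -/

section TranslationModulus

variable {F G : ℝ → ℂ}

lemma integrable_shift_sub (hG : Integrable G) (y : ℝ) : Integrable fun z => G (z - y) - G z :=
  (hG.comp_sub_right y).sub hG

lemma translationModulus_nonneg (y : ℝ) : 0 ≤ translationModulus G y :=
  integral_nonneg fun _ => norm_nonneg _

lemma translationModulus_le (hG : Integrable G) (y : ℝ) :
    translationModulus G y ≤ 2 * ∫ z, ‖G z‖ := by
  calc translationModulus G y ≤ ∫ z, (‖G (z - y)‖ + ‖G z‖) :=
        integral_mono (integrable_shift_sub hG y).norm ((hG.comp_sub_right y).norm.add hG.norm)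
          fun z => norm_sub_le _ _
    _ = 2 * ∫ z, ‖G z‖ := by
        rw [integral_add (hG.comp_sub_right y).norm hG.norm,
          integral_sub_right_eq_self (fun z => ‖G z‖) y]
        ring

/-- Translations act continuously on L¹. -/
lemma continuous_translationModulus (hG : Integrable G) : Continuous (translationModulus G) := by
  have hmp (y : ℝ) : MeasurePreserving (fun z : ℝ => z - y) volume volume :=
    measurePreserving_sub_right volume y
  let T : ℝ → C(ℝ, ℝ) := fun y => ⟨fun z => z - y, by fun_prop⟩
  have hT : Continuous T :=
    ContinuousMap.continuous_of_continuous_uncurry _ (by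
      simp only [T, Function.uncurry_def, ContinuousMap.coe_mk]; fun_prop)
  have hmem : MemLp G 1 volume := memLp_one_iff_integrable.2 hG
  have hc : Continuous fun y =>
      ‖Lp.compMeasurePreserving (T y) (hmp y) (hmem.toLp G) - hmem.toLp G‖ :=
    ((continuous_const (y := hmem.toLp G)).compMeasurePreservingLp hT hmp (by simp)).sub
      continuous_const |>.norm
  convert hc using 2 with y
  rw [L1.norm_eq_integral_norm]
  refine integral_congr_ae ?_
  filter_upwards [Lp.coeFn_sub (Lp.compMeasurePreserving (T y) (hmp y) (hmem.toLp G))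
    (hmem.toLp G), Lp.coeFn_compMeasurePreserving (hmem.toLp G) (hmp y), hmem.coeFn_toLp,
    (hmp y).quasiMeasurePreserving.ae hmem.coeFn_toLp] with z h1 h2 h3 h4
  rw [h1, Pi.sub_apply, h3]
  erw [h2]
  simp only [Function.comp_apply]
  rw [h4]

lemma tendsto_integral_mul_translationModulus (hF : Integrable F) (hG : Integrable G) :
    Tendsto (fun s : ℝ => ∫ y, ‖F y‖ * translationModulus G (s * y)) (𝓝 0) (𝓝 0) := by
  have h0 : translationModulus G 0 = 0 := by simp [translationModulus]
  have hc := continuous_translationModulus hG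
  have := tendsto_integral_filter_of_dominated_convergence (μ := volume) (l := 𝓝 (0 : ℝ))
    (F := fun s y => ‖F y‖ * translationModulus G (s * y)) (f := fun y => 0)
    (fun y => ‖F y‖ * (2 * ∫ z, ‖G z‖))
    (.of_forall fun s => hF.1.norm.mul (by fun_prop))
    (.of_forall fun s => .of_forall fun y => by
      rw [Real.norm_of_nonneg (mul_nonneg (norm_nonneg _) (translationModulus_nonneg _))]
      exact mul_le_mul_of_nonneg_left (translationModulus_le hG _) (norm_nonneg _))
    (hF.norm.mul_const _)
    (.of_forall fun y => by
      have : Continuous fun s : ℝ => ‖F y‖ * translationModulus G (s * y) := by fun_prop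
      simpa [h0] using this.tendsto 0)
  simpa using this

/-- The difference is ∫ F(y) (G(z - y) - G(z)) dy. The bound serves both when G is wide compared
with F and when F is an approximate identity. -/
lemma integral_norm_convolution_sub_le (hF : Integrable F) (hG : Integrable G) :
    ∫ z, ‖(F ⋆[ContinuousLinearMap.mul ℂ ℂ] G) z - (∫ y, F y) * G z‖
      ≤ ∫ y, ‖F y‖ * translationModulus G y := by
  have hint := hF.convolution_integrand (ContinuousLinearMap.mul ℂ ℂ) hG
  simp only [ContinuousLinearMap.mul_apply'] at hint
  have h2 : Integrable (fun p : ℝ × ℝ => F p.2 * (G (p.1 - p.2) - G p.1))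
      (volume.prod volume) := by
    refine (hint.sub (hG.mul_prod hF)).congr (.of_forall fun p => ?_)
    simp only [Pi.sub_apply]
    ring
  have h3 : ∀ᵐ z, Integrable fun y => F y * G (z - y) := by
    simpa using hint.prod_right_ae
  calc ∫ z, ‖(F ⋆[ContinuousLinearMap.mul ℂ ℂ] G) z - (∫ y, F y) * G z‖
      = ∫ z, ‖∫ y, F y * (G (z - y) - G z)‖ := by
        refine integral_congr_ae ?_
        filter_upwards [h3] with z hz
        simp only [convolution, ContinuousLinearMap.mul_apply', mul_sub]
        rw [integral_sub hz (hF.mul_const _), integral_mul_const]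
    _ ≤ ∫ z, ∫ y, ‖F y * (G (z - y) - G z)‖ := by
        refine integral_mono_of_nonneg (.of_forall fun _ => norm_nonneg _) ?_
          (.of_forall fun z => norm_integral_le_integral_norm _)
        exact h2.norm.integral_prod_left
    _ = ∫ y, ∫ z, ‖F y * (G (z - y) - G z)‖ := integral_integral_swap h2.norm
    _ = ∫ y, ‖F y‖ * translationModulus G y := by
        simp only [norm_mul, integral_const_mul, translationModulus]

end TranslationModulus

/-! ### Band-limited kernels and Wiener's theorem -/

section BandLimited

open scoped FourierTransform ContDiff SchwartzMap

variable {ψ F G g χ : ℝ → ℂ} {C : ℝ} {l : Filter ℝ}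

lemma exists_schwartz_fourierInv (hg : ContDiff ℝ ∞ g) (hgc : HasCompactSupport g) :
    ∃ h : 𝓢(ℝ, ℂ), (h : ℝ → ℂ) = 𝓕⁻ g ∧ 𝓕 (h : ℝ → ℂ) = g := by
  let s : 𝓢(ℝ, ℂ) := hgc.toSchwartzMap hg
  refine ⟨𝓕⁻ s, SchwartzMap.fourierInv_coe s, ?_⟩
  rw [← SchwartzMap.fourier_coe, FourierTransform.fourier_fourierInv_eq]
  rfl

lemma integrable_fourierInv (hg : ContDiff ℝ ∞ g) (hgc : HasCompactSupport g) :
    Integrable (𝓕⁻ g) := by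
  obtain ⟨h, h1, -⟩ := exists_schwartz_fourierInv hg hgc
  exact h1 ▸ h.integrable

lemma integral_fourierInv (hg : ContDiff ℝ ∞ g) (hgc : HasCompactSupport g) :
    ∫ y, 𝓕⁻ g y = g 0 := by
  obtain ⟨h, h1, h2⟩ := exists_schwartz_fourierInv hg hgc
  rw [← h1, ← h2, Real.fourier_real_eq_integral_exp_smul]
  simp

lemma fourierInv_add (hF : ContDiff ℝ ∞ F) (hFc : HasCompactSupport F) (hG : ContDiff ℝ ∞ G)
    (hGc : HasCompactSupport G) : 𝓕⁻ (F + G) = 𝓕⁻ F + 𝓕⁻ G := by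
  let s : 𝓢(ℝ, ℂ) := hFc.toSchwartzMap hF
  let t : 𝓢(ℝ, ℂ) := hGc.toSchwartzMap hG
  calc 𝓕⁻ (F + G) = ⇑(𝓕⁻ (s + t) : 𝓢(ℝ, ℂ)) := (SchwartzMap.fourierInv_coe (s + t)).symm
    _ = ⇑(𝓕⁻ s : 𝓢(ℝ, ℂ)) + ⇑(𝓕⁻ t : 𝓢(ℝ, ℂ)) := by rw [FourierTransform.fourierInv_add]; rfl
    _ = 𝓕⁻ F + 𝓕⁻ G := by rw [SchwartzMap.fourierInv_coe, SchwartzMap.fourierInv_coe]; rfl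

/-- On the Fourier side this is the hypothesis χ g = g, read in Schwartz space. -/
lemma fourierInv_convolution_fourierInv (hχ : ContDiff ℝ ∞ χ) (hχc : HasCompactSupport χ)
    (hg : ContDiff ℝ ∞ g) (hgc : HasCompactSupport g) (h : ∀ ξ, χ ξ * g ξ = g ξ) :
    𝓕⁻ χ ⋆[ContinuousLinearMap.mul ℂ ℂ] 𝓕⁻ g = 𝓕⁻ g := by
  obtain ⟨k, hk, hk'⟩ := exists_schwartz_fourierInv hχ hχc
  obtain ⟨u, hu, hu'⟩ := exists_schwartz_fourierInv hg hgc
  have key : SchwartzMap.convolution (ContinuousLinearMap.mul ℂ ℂ) k u = u := by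
    have : 𝓕 (SchwartzMap.convolution (ContinuousLinearMap.mul ℂ ℂ) k u) = 𝓕 u := by
      ext ξ
      rw [SchwartzMap.fourier_convolution, SchwartzMap.pairing_apply_apply, SchwartzMap.fourier_coe,
        SchwartzMap.fourier_coe, hk', hu']
      exact h ξ
    simpa using congrArg (fun s : 𝓢(ℝ, ℂ) => 𝓕⁻ s) this
  ext x
  rw [← hk, ← hu, ← SchwartzMap.convolution_apply, key]

lemma fourierInv_comp_div (χ : ℝ → ℂ) {a : ℝ} (ha : 0 < a) (x : ℝ) :
    𝓕⁻ (fun ξ => χ (ξ / a)) x = a * 𝓕⁻ χ (a * x) := by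
  rw [Real.fourierInv_eq', Real.fourierInv_eq']
  have := Measure.integral_comp_div
    (fun v : ℝ => Complex.exp (↑(2 * Real.pi * inner ℝ v (a * x)) * Complex.I) • χ v) a
  rw [abs_of_pos ha, Complex.real_smul] at this
  rw [← this]
  refine integral_congr_ae (.of_forall fun v => ?_)
  have : inner ℝ (v / a) (a * x) = inner ℝ v x := by
    simp; field_simp
  simp only [this]

lemma fourierInv_comp_add (g : ℝ → ℂ) (η x : ℝ) :
    𝓕⁻ (fun ξ => g (ξ + η)) x
      = Complex.exp (-(2 * Real.pi * η * x : ℝ) * Complex.I) * 𝓕⁻ g x := by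
  rw [Real.fourierInv_eq', Real.fourierInv_eq', ← integral_add_right_eq_self
    (fun v : ℝ => Complex.exp (↑(2 * Real.pi * inner ℝ v x) * Complex.I) • g v) η,
    ← integral_const_mul]
  refine integral_congr_ae (.of_forall fun v => ?_)
  simp only [smul_eq_mul, ← mul_assoc, ← Complex.exp_add]
  congr 2
  simp
  ring

lemma translationModulus_dilate (G : ℝ → ℂ) {a : ℝ} (ha : 0 < a) (y : ℝ) :
    translationModulus (fun x => a * G (a * x)) y = translationModulus G (a * y) := by
  have := Measure.integral_comp_mul_left (fun z : ℝ => ‖G (z - a * y) - G z‖) a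
  rw [translationModulus, translationModulus]
  rw [abs_of_pos (inv_pos.2 ha), smul_eq_mul] at this
  rw [eq_inv_mul_iff_mul_eq₀ ha.ne'] at this
  rw [← this, ← integral_const_mul]
  refine integral_congr_ae (.of_forall fun z => ?_)
  simp only [← mul_sub, norm_mul, Complex.norm_real, Real.norm_of_nonneg ha.le]

lemma exists_smooth_bump : ∃ χ : ℝ → ℂ, ContDiff ℝ ∞ χ ∧ HasCompactSupport χ ∧
    ∀ ξ, |ξ| ≤ 1 → χ ξ = 1 := by
  let b : ContDiffBump (0 : ℝ) := ⟨1, 2, one_pos, one_lt_two⟩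
  refine ⟨fun ξ => (b ξ : ℂ), Complex.ofRealCLM.contDiff.comp b.contDiff,
    b.hasCompactSupport.comp_left (g := fun t : ℝ => (t : ℂ)) Complex.ofReal_zero, fun ξ hξ => ?_⟩
  beta_reduce
  rw [b.one_of_mem_closedBall (by simpa [b] using hξ), Complex.ofReal_one]

lemma contDiff_comp_div (hχ : ContDiff ℝ ∞ χ) (a : ℝ) : ContDiff ℝ ∞ fun ξ => χ (ξ / a) :=
  hχ.comp (contDiff_id.div_const a)

lemma hasCompactSupport_comp_div (hχ : HasCompactSupport χ) {a : ℝ} (ha : a ≠ 0) :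
    HasCompactSupport fun ξ => χ (ξ / a) := by
  simpa [div_eq_mul_inv, Function.comp_def] using hχ.comp_homeomorph (Homeomorph.mulRight₀ a⁻¹ (inv_ne_zero ha))

lemma exists_bandLimited_tendsto_of_integral_ne_zero [l.IsCountablyGenerated]
    (hl : ∀ y : ℝ, Tendsto (fun ρ => ρ + y) l l)
    (hψ : StronglyMeasurable ψ) (hC : ∀ t, ‖ψ t‖ ≤ C) (hF : Integrable F)
    (hF0 : ∫ y, F y ≠ 0) (h : Tendsto (corr ψ F) l (𝓝 0)) :
    ∃ a > 0, ∀ g : ℝ → ℂ, ContDiff ℝ ∞ g → HasCompactSupport g → (∀ ξ, a ≤ |ξ| → g ξ = 0) →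
      Tendsto (corr ψ (𝓕⁻ g)) l (𝓝 0) := by
  obtain ⟨χ, hχ, hχc, hχ1⟩ := exists_smooth_bump
  have hκ := integrable_fourierInv hχ hχc
  set c := ∫ y, F y with hc
  have hcpos : 0 < ‖c‖ := norm_pos_iff.2 hF0
  -- The kernel k below has modulus of continuity that of 𝓕⁻ χ at a * y, so small a makes F * k - c
  -- k smaller than |c| in L¹.
  obtain ⟨a, hlt, ha⟩ : ∃ a : ℝ,
      ∫ y, ‖F y‖ * translationModulus (𝓕⁻ χ) (a * y) < ‖c‖ ∧ 0 < a :=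
    ((((tendsto_integral_mul_translationModulus hF hκ).mono_left
      nhdsWithin_le_nhds).eventually (gt_mem_nhds hcpos)).and
        (self_mem_nhdsWithin (s := Set.Ioi (0 : ℝ)))).exists
  refine ⟨a, ha, fun g hg hgc hga => ?_⟩
  have hu := integrable_fourierInv hg hgc
  have hχa := contDiff_comp_div hχ a
  have hχac := hasCompactSupport_comp_div hχc ha.ne'
  set k := 𝓕⁻ (fun ξ => χ (ξ / a)) with hk_def
  have hk : Integrable k := integrable_fourierInv hχa hχac
  have hk_eq : k = fun x => a * 𝓕⁻ χ (a * x) := funext (fourierInv_comp_div χ ha)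
  set θ := corr ψ (𝓕⁻ g) with hθ_def
  have hθm : StronglyMeasurable θ := stronglyMeasurable_corr hψ hu
  have hθC := norm_corr_le hC hu
  -- The cutoff χ(ξ / a) equals 1 wherever g is nonzero, so k reproduces 𝓕⁻ g.
  have hθk : corr θ k = θ := by
    rw [hθ_def, ← corr_convolution hψ hC hk hu,
      fourierInv_convolution_fourierInv hχa hχac hg hgc]
    intro ξ
    rcases le_or_gt a |ξ| with hξ | hξ
    · simp [hga ξ hξ]
    · rw [hχ1, one_mul]
      rw [abs_div, abs_of_pos ha]
      exact (div_le_one ha).2 hξ.le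
  have hθF : Tendsto (corr θ F) l (𝓝 0) := by
    rw [hθ_def, corr_corr_comm hψ hC hF hu]
    exact tendsto_corr hl (stronglyMeasurable_corr hψ hF) (norm_corr_le hC hF) hu h
  have hFk : Integrable (F ⋆[ContinuousLinearMap.mul ℂ ℂ] k) :=
    hF.integrable_convolution _ hk
  set D := (F ⋆[ContinuousLinearMap.mul ℂ ℂ] k) - fun z => c * k z with hD
  have hDI : Integrable D := hFk.sub (hk.const_mul c)
  have hDn : ∫ y, ‖D y‖ < ‖c‖ := by
    refine (integral_norm_convolution_sub_le hF hk).trans_lt ?_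
    simpa only [hk_eq, translationModulus_dilate (𝓕⁻ χ) ha] using hlt
  have hDθ (ρ : ℝ) : corr θ D ρ = corr θ F ρ - c * θ ρ := by
    rw [hD, corr_sub hθm hθC hFk (hk.const_mul c), corr_const_mul,
      corr_convolution hθm hθC hF hk, hθk]
  refine tendsto_zero_of_eq_add_corr hl (e := fun ρ => c⁻¹ * corr θ F ρ)
    (W := fun y => -c⁻¹ * D y) hθm hθC (hDI.const_mul _) ?_ ?_ fun ρ => ?_
  · simp only [norm_mul, norm_neg, norm_inv, integral_const_mul]
    rw [inv_mul_lt_iff₀ hcpos, mul_one]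
    exact hDn
  · simpa using hθF.const_mul c⁻¹
  · rw [corr_const_mul, hDθ]
    field_simp
    ring

/-- Modulating ψ and the kernels by opposite characters moves η to 0 and multiplies each correlation
by a unimodular factor. -/
lemma exists_bandLimited_tendsto [l.IsCountablyGenerated]
    (hl : ∀ y : ℝ, Tendsto (fun ρ => ρ + y) l l)
    (hψ : StronglyMeasurable ψ) (hC : ∀ t, ‖ψ t‖ ≤ C) (hF : Integrable F) (η : ℝ)
    (hF0 : 𝓕 F η ≠ 0) (h : Tendsto (corr ψ F) l (𝓝 0)) :
    ∃ a > 0, ∀ g : ℝ → ℂ, ContDiff ℝ ∞ g → HasCompactSupport g →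
      (∀ ξ, a ≤ |ξ - η| → g ξ = 0) → Tendsto (corr ψ (𝓕⁻ g)) l (𝓝 0) := by
  let e : ℝ → ℂ := fun t => Complex.exp ((2 * Real.pi * η * t : ℝ) * Complex.I)
  let e' : ℝ → ℂ := fun t => Complex.exp (-(2 * Real.pi * η * t : ℝ) * Complex.I)
  have hecont : Continuous e := by fun_prop
  have he'cont : Continuous e' := by fun_prop
  have hnorm (t : ℝ) : ‖e t‖ = 1 := Complex.norm_exp_ofReal_mul_I _
  have hnorm' (t : ℝ) : ‖e' t‖ = 1 := by
    simp only [e', ← Complex.ofReal_neg]; exact Complex.norm_exp_ofReal_mul_I _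
  have hmod (G : ℝ → ℂ) (ρ : ℝ) :
      corr (fun t => ψ t * e t) (fun y => e' y * G y) ρ = e ρ * corr ψ G ρ := by
    rw [corr, corr, ← integral_const_mul]
    refine integral_congr_ae (.of_forall fun y => ?_)
    have : e' y * e (ρ + y) = e ρ := by
      simp only [e, e', ← Complex.exp_add]
      congr 1
      push_cast
      ring
    simp only [← this]
    ring
  have hψe : StronglyMeasurable fun t => ψ t * e t := hψ.mul hecont.stronglyMeasurable
  have hCe (t : ℝ) : ‖ψ t * e t‖ ≤ C := by simpa [hnorm] using hC t
  have hFe : Integrable fun y => e' y * F y :=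
    hF.bdd_mul (c := 1) he'cont.aestronglyMeasurable (.of_forall fun t => (hnorm' t).le)
  have hlim (G : ℝ → ℂ) : Tendsto (corr (fun t => ψ t * e t) (fun y => e' y * G y)) l (𝓝 0) ↔
      Tendsto (corr ψ G) l (𝓝 0) := by
    rw [tendsto_zero_iff_norm_tendsto_zero, tendsto_zero_iff_norm_tendsto_zero (f := corr ψ G)]
    simp [hmod, hnorm]
  have hint : ∫ y, e' y * F y = 𝓕 F η := by
    rw [Real.fourier_real_eq_integral_exp_smul]
    refine integral_congr_ae (.of_forall fun y => ?_)
    simp only [e', smul_eq_mul]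
    congr 2
    push_cast
    ring
  obtain ⟨a, ha, H⟩ := exists_bandLimited_tendsto_of_integral_ne_zero hl hψe hCe hFe
    (hint ▸ hF0) ((hlim F).2 h)
  refine ⟨a, ha, fun g hg hgc hga => ?_⟩
  have := H (fun ξ => g (ξ + η)) (hg.comp (contDiff_id.add contDiff_const))
    (hgc.comp_homeomorph (Homeomorph.addRight η)) fun ξ hξ => hga _ (by simpa using hξ)
  rw [show 𝓕⁻ (fun ξ => g (ξ + η)) = fun x => e' x * 𝓕⁻ g x from
    funext (fourierInv_comp_add g η), hlim] at this
  exact this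

/-- Splitting of a test function subordinate to a cover of its support by two open sets. -/
lemma exists_add_of_tsupport_subset_union {U V : Set ℝ} (hU : IsOpen U) (hV : IsOpen V)
    (hg : ContDiff ℝ ∞ g) (hgc : HasCompactSupport g) (hgUV : tsupport g ⊆ U ∪ V) :
    ∃ g₁ g₂ : ℝ → ℂ, g = g₁ + g₂ ∧ (ContDiff ℝ ∞ g₁ ∧ HasCompactSupport g₁ ∧ tsupport g₁ ⊆ U) ∧
      ContDiff ℝ ∞ g₂ ∧ HasCompactSupport g₂ ∧ tsupport g₂ ⊆ V := by
  have hdisj : Disjoint Uᶜ (tsupport g \ V) := by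
    rw [Set.disjoint_left]
    intro x hx hx'
    exact (hgUV hx'.1).elim hx hx'.2
  -- b vanishes near the complement of U and equals 1 near `tsupport g \ V`; neighbourhoods are
  -- needed to control closed supports.
  obtain ⟨b, hb0, hb1, -⟩ := exists_contMDiffMap_zero_one_nhds_of_isClosed (n := (⊤ : ℕ∞))
    (modelWithCornersSelf ℝ ℝ) hU.isClosed_compl
    ((isClosed_tsupport g).sdiff hV) hdisj
  have hb : ContDiff ℝ ∞ fun x => (b x : ℂ) :=
    Complex.ofRealCLM.contDiff.comp b.contMDiff.contDiff
  have hb' : ContDiff ℝ ∞ fun x => (1 - b x : ℂ) := contDiff_const.sub hb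
  refine ⟨fun x => b x * g x, fun x => (1 - b x) * g x, by ext x; simp; ring,
    ⟨hb.mul hg, hgc.mul_left, ?_⟩, hb'.mul hg, hgc.mul_left, ?_⟩
  · intro x hx
    by_contra hxU
    have := hb0.filter_mono (nhds_le_nhdsSet hxU)
    refine (notMem_tsupport_iff_eventuallyEq.2 ?_) hx
    filter_upwards [this] with y hy
    simp [hy]
  · intro x hx
    by_contra hxV
    have hxg : x ∈ tsupport g := tsupport_mul_subset_right hx
    have := hb1.filter_mono (nhds_le_nhdsSet (Set.mem_sdiff_of_mem hxg hxV))
    refine (notMem_tsupport_iff_eventuallyEq.2 ?_) hx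
    filter_upwards [this] with y hy
    simp [hy]

lemma tendsto_corr_fourierInv [l.IsCountablyGenerated]
    (hl : ∀ y : ℝ, Tendsto (fun ρ => ρ + y) l l)
    (hψ : StronglyMeasurable ψ) (hC : ∀ t, ‖ψ t‖ ≤ C) (hF : Integrable F)
    (hF0 : ∀ η, 𝓕 F η ≠ 0) (h : Tendsto (corr ψ F) l (𝓝 0))
    (hg : ContDiff ℝ ∞ g) (hgc : HasCompactSupport g) :
    Tendsto (corr ψ (𝓕⁻ g)) l (𝓝 0) := by
  have key : ∃ U : Set ℝ, IsOpen U ∧ tsupport g ⊆ U ∧ ∀ g' : ℝ → ℂ, ContDiff ℝ ∞ g' →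
      HasCompactSupport g' → tsupport g' ⊆ U → Tendsto (corr ψ (𝓕⁻ g')) l (𝓝 0) := by
    -- Compact induction: the property holds locally by the previous lemma and passes to unions by
    -- splitting the test function.
    have hK : IsCompact (tsupport g) := hgc
    refine hK.induction_on (p := fun s => ∃ U : Set ℝ, IsOpen U ∧ s ⊆ U ∧ ∀ g' : ℝ → ℂ,
      ContDiff ℝ ∞ g' → HasCompactSupport g' → tsupport g' ⊆ U →
        Tendsto (corr ψ (𝓕⁻ g')) l (𝓝 0)) ?_ ?_ ?_ ?_
    · refine ⟨∅, isOpen_empty, subset_rfl, fun g' _ _ hs => ?_⟩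
      have : g' = 0 := tsupport_eq_empty_iff.1 (Set.subset_empty_iff.1 hs)
      have h0 : corr ψ (𝓕⁻ g') = fun _ => 0 := by
        ext ρ
        simp [corr, this, Real.fourierInv_eq']
      rw [h0]
      exact tendsto_const_nhds
    · rintro s t hst ⟨U, hU, htU, H⟩
      exact ⟨U, hU, hst.trans htU, H⟩
    · rintro s t ⟨U, hU, hsU, HU⟩ ⟨V, hV, htV, HV⟩
      refine ⟨U ∪ V, hU.union hV, Set.union_subset_union hsU htV, fun g' hg' hgc' hs => ?_⟩
      obtain ⟨g₁, g₂, rfl, ⟨h1, h1c, h1s⟩, h2, h2c, h2s⟩ :=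
        exists_add_of_tsupport_subset_union hU hV hg' hgc' hs
      have := (HU g₁ h1 h1c h1s).add (HV g₂ h2 h2c h2s)
      rw [add_zero] at this
      refine this.congr fun ρ => ?_
      rw [fourierInv_add h1 h1c h2 h2c, corr_add hψ hC (integrable_fourierInv h1 h1c)
        (integrable_fourierInv h2 h2c)]
    · intro η _
      obtain ⟨a, ha, H⟩ := exists_bandLimited_tendsto hl hψ hC hF η (hF0 η) h
      refine ⟨Metric.ball η a, mem_nhdsWithin_of_mem_nhds (Metric.ball_mem_nhds η ha),
        Metric.ball η a, Metric.isOpen_ball, subset_rfl, fun g' hg' hgc' hs =>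
          H g' hg' hgc' fun ξ hξ => ?_⟩
      refine image_eq_zero_of_notMem_tsupport fun hmem => ?_
      have := Metric.mem_ball.1 (hs hmem)
      rw [Real.dist_eq] at this
      exact absurd hξ (not_le.2 this)
  obtain ⟨U, -, hgU, H⟩ := key
  exact H g hg hgc hgU

/-- **Wiener's Tauberian theorem.** -/
theorem wiener_tauberian [l.IsCountablyGenerated]
    (hl : ∀ y : ℝ, Tendsto (fun ρ => ρ + y) l l)
    (hψ : StronglyMeasurable ψ) (hC : ∀ t, ‖ψ t‖ ≤ C) (hF : Integrable F)
    (hF0 : ∀ η, 𝓕 F η ≠ 0) (h : Tendsto (corr ψ F) l (𝓝 0)) (hG : Integrable G) :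
    Tendsto (corr ψ G) l (𝓝 0) := by
  obtain ⟨χ, hχ, hχc, hχ1⟩ := exists_smooth_bump
  have hκ := integrable_fourierInv hχ hχc
  have hC0 : 0 ≤ C := (norm_nonneg _).trans (hC 0)
  have happrox : Tendsto (fun s : ℝ => C * ∫ y, ‖𝓕⁻ χ y‖ * translationModulus G (s * y))
      (𝓝[>] 0) (𝓝 0) := by
    simpa using ((tendsto_integral_mul_translationModulus hκ hG).mono_left
      nhdsWithin_le_nhds).const_mul C
  rw [Metric.tendsto_nhds]
  intro ε hε
  -- The kernel k below is an approximate identity at scale s, and C‖k * G - G‖₁ is at most the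
  -- quantity made small here.
  obtain ⟨s, hs, hspos⟩ : ∃ s : ℝ,
      C * ∫ y, ‖𝓕⁻ χ y‖ * translationModulus G (s * y) < ε / 2 ∧ 0 < s :=
    ((happrox.eventually (gt_mem_nhds (half_pos hε))).and
      (self_mem_nhdsWithin (s := Set.Ioi (0 : ℝ)))).exists
  have hs' : 0 < s⁻¹ := inv_pos.2 hspos
  have hχa := contDiff_comp_div hχ s⁻¹
  have hχac := hasCompactSupport_comp_div hχc hs'.ne'
  set k := 𝓕⁻ (fun ξ => χ (ξ / s⁻¹)) with hk_def
  have hk : Integrable k := integrable_fourierInv hχa hχac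
  have hk_eq : k = fun x => (s⁻¹ : ℝ) * 𝓕⁻ χ (s⁻¹ * x) := funext (fourierInv_comp_div χ hs')
  have hk1 : ∫ y, k y = 1 := by
    rw [hk_def, integral_fourierInv hχa hχac, zero_div, hχ1 0 (by simp)]
  -- k has compactly supported spectrum, so `corr ψ k` tends to 0; correlating with G preserves
  -- this.
  have hkG : Tendsto (corr ψ (k ⋆[ContinuousLinearMap.mul ℂ ℂ] G)) l (𝓝 0) := by
    rw [corr_convolution hψ hC hk hG, corr_corr_comm hψ hC hk hG]
    exact tendsto_corr hl (stronglyMeasurable_corr hψ hk) (norm_corr_le hC hk) hG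
      (tendsto_corr_fourierInv hl hψ hC hF hF0 h hχa hχac)
  have hconv : Integrable (k ⋆[ContinuousLinearMap.mul ℂ ℂ] G) :=
    hk.integrable_convolution _ hG
  have hdiff : ∫ z, ‖((k ⋆[ContinuousLinearMap.mul ℂ ℂ] G) - G) z‖
      ≤ ∫ y, ‖𝓕⁻ χ y‖ * translationModulus G (s * y) := by
    have h1 := integral_norm_convolution_sub_le hk hG
    simp only [hk1, one_mul] at h1
    refine h1.trans_eq ?_
    have := Measure.integral_comp_mul_left
      (fun y : ℝ => ‖𝓕⁻ χ y‖ * translationModulus G (s * y)) s⁻¹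
    rw [inv_inv, abs_of_pos hspos, smul_eq_mul, eq_comm, ← eq_inv_mul_iff_mul_eq₀ hspos.ne'] at this
    rw [this, ← integral_const_mul, hk_eq]
    refine integral_congr_ae (.of_forall fun y => ?_)
    simp only [norm_mul, Complex.norm_real, Real.norm_of_nonneg hs'.le,
      mul_inv_cancel_left₀ hspos.ne', mul_assoc]
  filter_upwards [Metric.tendsto_nhds.1 hkG (ε / 2) (half_pos hε)] with ρ hρ
  rw [dist_zero_right] at hρ ⊢
  have h2 := norm_corr_le hC (hconv.sub hG) ρ
  rw [corr_sub hψ hC hconv hG] at h2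
  have h3 := mul_le_mul_of_nonneg_left hdiff hC0
  have h4 := norm_sub_norm_le (corr ψ G ρ) (corr ψ (k ⋆[ContinuousLinearMap.mul ℂ ℂ] G) ρ)
  rw [norm_sub_rev] at h4
  linarith

end BandLimited

/-! ### Passage from dilations to translations -/

section MultiplicativeForm

open scoped FourierTransform

variable {E : Type*} [NormedAddCommGroup E] [NormedSpace ℝ E]

lemma image_exp_neg_univ : (fun u : ℝ => Real.exp (-u)) '' Set.univ = Set.Ioi 0 := by
  rw [← Set.image_image Real.exp Neg.neg, Set.image_univ_of_surjective neg_surjective,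
    Set.image_univ, Real.range_exp]

lemma hasDerivWithinAt_exp_neg (u : ℝ) :
    HasDerivWithinAt (fun u : ℝ => Real.exp (-u)) (-Real.exp (-u)) Set.univ u := by
  simpa using (hasDerivAt_neg u).exp

lemma injOn_exp_neg : Set.univ.InjOn fun u : ℝ => Real.exp (-u) :=
  (Real.exp_injective.comp neg_injective).injOn

lemma integral_Ioi_eq_integral_exp_neg (K : ℝ → E) :
    ∫ t in Set.Ioi 0, K t = ∫ u, Real.exp (-u) • K (Real.exp (-u)) := by
  rw [← image_exp_neg_univ, integral_image_eq_integral_abs_deriv_smul MeasurableSet.univ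
    (fun u _ => hasDerivWithinAt_exp_neg u) injOn_exp_neg]
  simp

lemma integrable_exp_neg_of_integrableOn_Ioi {K : ℝ → E} (hK : IntegrableOn K (Set.Ioi 0)) :
    Integrable fun u => Real.exp (-u) • K (Real.exp (-u)) := by
  rw [← image_exp_neg_univ, integrableOn_image_iff_integrableOn_abs_deriv_smul MeasurableSet.univ
    (fun u _ => hasDerivWithinAt_exp_neg u) injOn_exp_neg] at hK
  simpa using hK

lemma integral_eq_integral_Ioi_add_neg {K : ℝ → E} (hK : Integrable K) :
    ∫ t, K t = ∫ t in Set.Ioi 0, (K (-t) + K t) := by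
  rw [integral_add hK.comp_neg.integrableOn hK.integrableOn, integral_comp_neg_Ioi, neg_zero,
    intervalIntegral.integral_Iic_add_Ioi hK.integrableOn hK.integrableOn]

/-- The kernel on the additive group that corresponds to `f` on the multiplicative group `(0, ∞)`. -/
noncomputable def logKernel (f : ℝ → ℝ) (u : ℝ) : ℂ := Real.exp (-u) • (f (Real.exp (-u)) : ℂ)

variable {f : ℝ → ℝ} {φ : ℝ → ℂ} {C : ℝ}

lemma integrable_logKernel (hf : Integrable f) : Integrable (logKernel f) :=
  integrable_exp_neg_of_integrableOn_Ioi (K := fun t => (f t : ℂ)) hf.ofReal.integrableOn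

lemma integral_logKernel (hf : MemP f) (hf_even : IsEvenAE f) : ∫ u, logKernel f u = 1 / 2 := by
  have h1 := integral_eq_integral_Ioi_add_neg hf.integrable
  have h2 : ∫ t in Set.Ioi 0, (f (-t) + f t) = 2 * ∫ t in Set.Ioi 0, f t := by
    rw [← integral_const_mul]
    refine integral_congr_ae (ae_restrict_of_ae (hf_even.mono fun t ht => ?_))
    simp only [ht]
    ring
  rw [hf.integral_eq_one, h2] at h1
  have h3 : ∫ t in Set.Ioi 0, (f t : ℂ) = ∫ u, logKernel f u :=
    integral_Ioi_eq_integral_exp_neg _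
  rw [← h3, integral_complex_ofReal, show ∫ t in Set.Ioi 0, f t = 1 / 2 by linarith]
  norm_num

lemma fourier_logKernel (f : ℝ → ℝ) (η : ℝ) : 𝓕 (logKernel f) η =
    ∫ t in Set.Ioi (0 : ℝ), (f t : ℂ) * (t : ℂ) ^ (Complex.I * ((2 * Real.pi * η : ℝ) : ℂ)) := by
  -- Real part 1 produces the weight e^{-u} of `logKernel`; the imaginary part divided by 2π is the
  -- frequency.
  have := mellin_eq_fourier (fun t => (f t : ℂ)) (s := 1 + Complex.I * (2 * Real.pi * η : ℝ))
  have h1 : (1 + Complex.I * (2 * Real.pi * η : ℝ) : ℂ).re = 1 := by simp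
  have h2 : (1 + Complex.I * (2 * Real.pi * η : ℝ) : ℂ).im = 2 * Real.pi * η := by simp
  rw [h1, h2, mul_div_cancel_left₀ _ (by positivity)] at this
  simp only [neg_one_mul] at this
  rw [show logKernel f = fun u => Real.exp (-u) • (f (Real.exp (-u)) : ℂ) from rfl, ← this, mellin]
  simp [mul_comm]

lemma integral_dilate_smul (φ : ℝ → ℂ) {r : ℝ} (hr : 0 < r) (x : ℝ) :
    ∫ t, dilate f r t • φ (x - t) = ∫ s, f s • φ (x - r * s) := by
  have := Measure.integral_comp_div (fun s => f s • φ (x - r * s)) r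
  rw [abs_of_pos hr] at this
  rw [← inv_smul_eq_iff₀ hr.ne', ← integral_smul] at this
  rw [← this]
  refine integral_congr_ae (.of_forall fun t => ?_)
  simp only [dilate, mul_div_cancel₀ t hr.ne', smul_smul]

lemma integral_dilate_smul_eq_corr (hf : Integrable f) (hf_even : IsEvenAE f)
    (hφ : StronglyMeasurable φ) (hC : ∀ t, ‖φ t‖ ≤ C) (x ρ : ℝ) :
    ∫ t, dilate f (Real.exp (-ρ)) t • φ (x - t) =
      corr (fun u => φ (x - Real.exp (-u)) + φ (x + Real.exp (-u))) (logKernel f) ρ := by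
  have hI : Integrable fun s => f s • φ (x - Real.exp (-ρ) * s) := by
    refine hf.smul_bdd C ?_ (.of_forall fun t => hC _)
    exact (hφ.comp_measurable (by fun_prop)).aestronglyMeasurable
  rw [integral_dilate_smul φ (Real.exp_pos _), integral_eq_integral_Ioi_add_neg hI]
  calc ∫ s in Set.Ioi 0, (f (-s) • φ (x - Real.exp (-ρ) * -s) + f s • φ (x - Real.exp (-ρ) * s))
      = ∫ s in Set.Ioi 0,
          (f s : ℂ) * (φ (x - Real.exp (-ρ) * s) + φ (x + Real.exp (-ρ) * s)) := by
        refine integral_congr_ae (ae_restrict_of_ae (hf_even.mono fun s hs => ?_))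
        simp only [hs, Complex.real_smul, mul_neg, sub_neg_eq_add]
        ring
    _ = _ := by
        rw [integral_Ioi_eq_integral_exp_neg, corr]
        refine integral_congr_ae (.of_forall fun u => ?_)
        simp only [logKernel, neg_add, Real.exp_add, smul_mul_assoc]

/-- A measurable representative is set to 0 where it exceeds the essential supremum. The correlation
lemmas require a bound at every point. -/
lemma exists_bounded_stronglyMeasurable_ae_eq {X : Type*} [MeasurableSpace X] {μ : Measure X}
    {F : Type*} [NormedAddCommGroup F] {φ : X → F} (hφ : MemLp φ ∞ μ) :
    ∃ (φ' : X → F) (C : ℝ), StronglyMeasurable φ' ∧ (∀ t, ‖φ' t‖ ≤ C) ∧ φ =ᵐ[μ] φ' := by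
  set C := (eLpNorm φ ∞ μ).toReal
  set m := hφ.1.mk φ
  have hm : StronglyMeasurable m := hφ.1.stronglyMeasurable_mk
  have hS : MeasurableSet {t | ‖m t‖ ≤ C} := hm.norm.measurable measurableSet_Iic
  refine ⟨{t | ‖m t‖ ≤ C}.indicator m, C, hm.indicator hS, fun t => ?_, ?_⟩
  · by_cases ht : t ∈ {t | ‖m t‖ ≤ C}
    · rw [Set.indicator_of_mem ht]; exact ht
    · rw [Set.indicator_of_notMem ht, norm_zero]; exact ENNReal.toReal_nonneg
  · filter_upwards [hφ.1.ae_eq_mk, ae_le_eLpNormEssSup (f := φ) (μ := μ)] with t h1 h2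
    have : ‖m t‖ ≤ C := by
      rw [← eLpNorm_exponent_top] at h2
      have := ENNReal.toReal_mono hφ.2.ne h2
      rwa [toReal_enorm, h1] at this
    rw [Set.indicator_of_mem (show t ∈ {t | ‖m t‖ ≤ C} from this), h1]

lemma tendsto_convolution_dilate {l γ : Filter ℝ} [l.IsCountablyGenerated]
    (hl : ∀ y : ℝ, Tendsto (fun ρ => ρ + y) l l)
    (hexp : Tendsto (fun ρ => Real.exp (-ρ)) l γ) (hlog : Tendsto (fun r => -Real.log r) γ l)
    (hpos : ∀ᶠ r in γ, 0 < r) {φ : ℝ → ℂ} (hφ : MemLp φ ∞ volume)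
    {f g : ℝ → ℝ} (hf : MemP f) (hf_even : IsEvenAE f)
    (hf_mellin : ∀ ξ : ℝ, ∫ t in Set.Ioi (0 : ℝ), (f t : ℂ) * (t : ℂ) ^ (Complex.I * (ξ : ℂ)) ≠ 0)
    (hg : MemP g) (hg_even : IsEvenAE g) (x : ℝ) (α : ℂ)
    (h : Tendsto (fun r : ℝ => (dilate f r ⋆ φ) x) γ (𝓝 α)) :
    Tendsto (fun r : ℝ => (dilate g r ⋆ φ) x) γ (𝓝 α) := by
  obtain ⟨φ', C, hφ', hC, hae⟩ := exists_bounded_stronglyMeasurable_ae_eq hφ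
  set ψ : ℝ → ℂ := fun u => φ' (x - Real.exp (-u)) + φ' (x + Real.exp (-u)) with hψ_def
  have hψ : StronglyMeasurable ψ :=
    (hφ'.comp_measurable (by fun_prop)).add (hφ'.comp_measurable (by fun_prop))
  have hψC (t : ℝ) : ‖ψ t‖ ≤ C + C := norm_add_le_of_le (hC _) (hC _)
  -- Each `logKernel` has integral 1/2, so subtracting 2α from ψ subtracts α from the correlation.
  have hψα : StronglyMeasurable fun u => ψ u - 2 * α := hψ.sub stronglyMeasurable_const
  have hψαC (t : ℝ) : ‖ψ t - 2 * α‖ ≤ C + C + ‖2 * α‖ := norm_sub_le_of_le (hψC t) le_rfl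
  have hconv {k : ℝ → ℝ} (hk : MemP k) (hk_even : IsEvenAE k) (ρ : ℝ) :
      corr (fun u => ψ u - 2 * α) (logKernel k) ρ = (dilate k (Real.exp (-ρ)) ⋆ φ) x - α := by
    have h1 : (dilate k (Real.exp (-ρ)) ⋆ φ) x =
        ∫ t, dilate k (Real.exp (-ρ)) t • φ' (x - t) := by
      refine integral_congr_ae ?_
      filter_upwards [(Measure.measurePreserving_sub_left volume x).quasiMeasurePreserving.ae hae] with t ht
      simp [ht]
    have hkI := integrable_logKernel hk.integrable
    rw [h1, integral_dilate_smul_eq_corr hk.integrable hk_even hφ' hC, corr, corr]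
    simp only [mul_sub]
    rw [integral_sub (integrable_mul_shift hψ hψC hkI ρ) (hkI.mul_const _), integral_mul_const,
      integral_logKernel hk hk_even]
    ring
  have hF0 (η : ℝ) : 𝓕 (logKernel f) η ≠ 0 := by
    rw [fourier_logKernel]
    exact hf_mellin _
  have hf_lim : Tendsto (corr (fun u => ψ u - 2 * α) (logKernel f)) l (𝓝 0) := by
    have := (h.comp hexp).sub_const α
    rw [sub_self] at this
    exact this.congr fun ρ => (hconv hf hf_even ρ).symm
  have hg_lim := wiener_tauberian hl hψα hψαC (integrable_logKernel hf.integrable) hF0 hf_lim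
    (integrable_logKernel hg.integrable)
  have := (hg_lim.comp hlog).add_const α
  rw [zero_add] at this
  refine this.congr' ?_
  filter_upwards [hpos] with r hr
  simp [hconv hg hg_even, Real.exp_log hr]

end MultiplicativeForm

theorem theorem4p5
    (φ : ℝ → ℂ) (hφ : MemLp φ ∞ volume)
    (f : ℝ → ℝ) (hf : MemP f) (hf_even : IsEvenAE f)
    (hf_mellin : ∀ ξ : ℝ, ∫ t in Set.Ioi (0 : ℝ), (f t : ℂ) * (t : ℂ) ^ (Complex.I * (ξ : ℂ)) ≠ 0)
    (γ : Filter ℝ) (hγ : γ = 𝓝[>] (0 : ℝ) ∨ γ = atTop)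
    (x : ℝ) (α : ℂ)
    (h : Tendsto (fun r : ℝ => (dilate f r ⋆ φ) x) γ (𝓝 α))
    (g : ℝ → ℝ) (hg : MemP g) (hg_even : IsEvenAE g) :
    Tendsto (fun r : ℝ => (dilate g r ⋆ φ) x) γ (𝓝 α) := by
  rcases hγ with rfl | rfl
  -- Since r = e^{-ρ}, r → 0⁺ corresponds to ρ → ∞ and r → ∞ to ρ → -∞.
  · exact tendsto_convolution_dilate (l := atTop) (fun y => tendsto_atTop_add_const_right _ y tendsto_id)
      (tendsto_nhdsWithin_iff.2 ⟨Real.tendsto_exp_neg_atTop_nhds_zero,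
        .of_forall fun ρ => Real.exp_pos _⟩)
      (tendsto_neg_atBot_atTop.comp Real.tendsto_log_nhdsGT_zero) self_mem_nhdsWithin
      hφ hf hf_even hf_mellin hg hg_even x α h
  · exact tendsto_convolution_dilate (l := atBot) (fun y => tendsto_atBot_add_const_right _ y tendsto_id)
      (Real.tendsto_exp_atTop.comp tendsto_neg_atBot_atTop)
      (tendsto_neg_atTop_atBot.comp Real.tendsto_log_atTop) (eventually_gt_atTop 0)
      hφ hf hf_even hf_mellin hg hg_even x α h
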